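/- Let $f_1,f_2$ be continuous probability density functions on $\mathbb{R}^d$ (with respect to Lebesgue measure). For each $n$, let the training sample consist of $n=n_1+n_2$ independent random points in $\mathbb{R}^d$, of which $n_1=n_1(n)$ have density $f_1$ (Class 1, the majority class) and $n_2=n_2(n)$ have density $f_2$ (Class 2, the minority class); the class labels of the training points are known and $n_1,n_2$ are non-random. Fix a query point $x\in\mathbb{R}^d$. Let $N_k(x)$ be the minimum number of nearest neighbors of $x$ in the pooled sample (in Euclidean distance) needed to get $k$ neighbors from Class 2. Put $p_0=n_2/n$, $$f^{(k)}(m)=\binom{m-1}{k-1}p_0^k(1-p_0)^{m-k}\quad(m=k,k+1,\ldots),\qquad f^{(k)}(m)=0\quad (m<k),$$ the negative binomial probability mass function with parameters $k$ and $p_0$, and define $$e_k(x)=\sum_{m<N_k(x)}f^{(k)}(m)+\tfrac12 f^{(k)}(N_k(x)),\qquad \mathcal{E}_1=\max_{1\le k\le k_{\max}}e_k(x),\qquad \mathcal{E}_2=1-\min_{1\le k\le k_{\max}}e_k(x).$$ The classifier assigns $x$ to Class 1 if $\mathcal{E}_1>\mathcal{E}_2$ and to Class 2 if $\mathcal{E}_1<\mathcal{E}_2$.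 Theorem. Assume that, as $n\to\infty$, (i) $n_i/n\to\pi_i\in(0,1)$ for $i=1,2$, where $\pi_1\ge\pi_2$ and $\pi_1+\pi_2=1$, and (ii) $k_{\max}=k_{\max}(n)\to\infty$ and $k_{\max}/n\to0$. Let $\{i,j\}=\{1,2\}$. If $f_i(x)>f_j(x)$, then the probability that the classifier assigns $x$ to Class $i$ tends to $1$ as $n\to\infty$. -/

import Mathlib

open MeasureTheory ProbabilityTheory Filter
open scoped Topology

namespace ImbalancedNN

/-- Probability mass function at `m` of the negative binomial distribution with parameters `k ≥ 1`
and `p`: the number of Bernoulli(`p`) trials needed to see `k` successes. -/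
noncomputable def negBinomialPMF (k : ℕ) (p : ℝ) (m : ℕ) : ℝ :=
  if k ≤ m then ((m - 1).choose (k - 1) : ℝ) * p ^ k * (1 - p) ^ (m - k) else 0

/-- Indices of a pooled training sample with `s i` observations in class `i`.
Index `0` is Class-1 (the majority class), index `1` is Class-2 (the minority class). -/
abbrev SampleIdx (s : Fin 2 → ℕ) : Type := Σ i : Fin 2, Fin (s i)

section Classifier

variable {E : Type*} [PseudoMetricSpace E] {s : Fin 2 → ℕ}

/-- `S` consists of the `S.card` nearest neighbors of `x` in the pooled sample `z`: no observation
outside `S` is strictly closer to `x` than one in `S`. -/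
def IsNeighborSet (x : E) (z : SampleIdx s → E) (S : Finset (SampleIdx s)) : Prop :=
  ∀ a ∈ S, ∀ b ∉ S, dist (z a) x ≤ dist (z b) x

/-- `N_k(x)`: the minimum number of nearest neighbors of `x` needed to get `k` neighbors from the
minority class. -/
noncomputable def neighborsNeeded (x : E) (z : SampleIdx s → E) (k : ℕ) : ℕ :=
  sInf {m : ℕ | ∃ S : Finset (SampleIdx s), IsNeighborSet x z S ∧ S.card = m ∧
    k ≤ (S.filter (fun a => a.1 = 1)).card}

/-- The proportion `p₀ = n₂ / (n₁ + n₂)` of minority class observations in the sample. -/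
noncomputable def minorityProportion (s : Fin 2 → ℕ) : ℝ :=
  (s 1 : ℝ) / ((s 0 : ℝ) + (s 1 : ℝ))

/-- The adjusted p-value
`e_k(x) = ∑_{m < N_k(x)} f_k(m) + f_k(N_k(x)) / 2`,
where `f_k` is the negative binomial p.m.f. with parameters `k` and `p₀`. -/
noncomputable def evidence (x : E) (z : SampleIdx s → E) (k : ℕ) : ℝ :=
  (∑ m ∈ Finset.range (neighborsNeeded x z k), negBinomialPMF k (minorityProportion s) m)
    + (1 / 2) * negBinomialPMF k (minorityProportion s) (neighborsNeeded x z k)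

/-- Strongest evidence for Class-1: the maximum of `e_k(x)` over `1 ≤ k ≤ K`. -/
noncomputable def strongestEvidence₁ (x : E) (z : SampleIdx s → E) (K : ℕ) : ℝ :=
  ⨆ k : Finset.Icc 1 K, evidence x z (k : ℕ)

/-- Strongest evidence for Class-2: one minus the minimum of `e_k(x)` over `1 ≤ k ≤ K`. -/
noncomputable def strongestEvidence₂ (x : E) (z : SampleIdx s → E) (K : ℕ) : ℝ :=
  1 - ⨅ k : Finset.Icc 1 K, evidence x z (k : ℕ)

/-- The classifier assigns `x` to class `i`: the strongest evidence for class `i` strictly exceeds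
the strongest evidence for the other class (in case of equality, `x` counts as assigned to
neither class). -/
def AssignedTo (x : E) (z : SampleIdx s → E) (K : ℕ) (i : Fin 2) : Prop :=
  if i = 0 then strongestEvidence₂ x z K < strongestEvidence₁ x z K
  else strongestEvidence₁ x z K < strongestEvidence₂ x z K

end Classifier

end ImbalancedNN

/-! If the two densities agreed at `x`, then `N_k(x)` would be near `k / π₂`, the approximate mean
of the negative binomial law. A larger majority density pushes `N_k(x)` above `β k` for some `β > 1
/ π₂`, so that `e_k(x)` is exponentially close to 1; a larger minority density pushes it below `β k`
with `β < 1 / π₂`, so that `e_k(x)` is exponentially small.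

To control `N_k(x)`, take the ball around `x` of volume `k / (n₂ c)`, with `c` strictly between the
two densities. `N_k(x)` compares deterministically with the numbers of points of each class in it
(`add_ballCount_le_neighborsNeeded`, `neighborsNeeded_le_add_ballCount`), and Chernoff bounds
control these. As `k_max / n → 0`, all these balls are small enough for continuity to apply, and the
`k`-th failure has probability at most `2 ρ ^ k`, with `ρ` independent of `k` and `n`.

These bounds say little for small `k`. The failures with `k ≥ k₀` have total probability at most a
geometric tail, small for large `k₀` uniformly in `n` (`tendsto_measure_one_of_forall_notMem`). For
`k ≤ k₀` it suffices that `e_k(x)` keeps a fixed distance `η` from the wrong extreme, 0 or 1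
(`pow_div_two_le_evidence`, `evidence_le_one_sub`). As `k_max → ∞`, the single value at `k = k_max`
comes within `η` of the right extreme and decides. -/

namespace ImbalancedNN

/-! ### Tails of the negative binomial distribution -/

section NegativeBinomial

variable {k : ℕ} {p q β s t : ℝ}

theorem negBinomialPMF_nonneg (hp : 0 ≤ p) (hp1 : p ≤ 1) (m : ℕ) : 0 ≤ negBinomialPMF k p m := by
  have : 0 ≤ 1 - p := by linarith
  unfold negBinomialPMF
  split_ifs <;> positivity

/-- The probability generating function of the negative binomial distribution. -/
theorem hasSum_negBinomialPMF_mul_pow (hk : 1 ≤ k) (hs : ‖(1 - p) * s‖ < 1) :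
    HasSum (fun m => negBinomialPMF k p m * s ^ m) ((p * s / (1 - (1 - p) * s)) ^ k) := by
  obtain ⟨l, rfl⟩ : ∃ l, k = l + 1 := ⟨k - 1, by omega⟩
  have h := (hasSum_choose_mul_geometric_of_norm_lt_one l hs).mul_left ((p * s) ^ (l + 1))
  rw [mul_one_div, ← div_pow] at h
  have hz : ∑ m ∈ Finset.range (l + 1), negBinomialPMF (l + 1) p m * s ^ m = 0 :=
    Finset.sum_eq_zero fun m hm => by
      rw [negBinomialPMF, if_neg (by simpa using hm), zero_mul]
  rw [← hasSum_nat_add_iff' (l + 1), hz, sub_zero]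
  refine h.congr_fun ?_
  intro m
  rw [negBinomialPMF, if_pos (by omega), Nat.add_sub_cancel, Nat.add_sub_cancel,
    show m + (l + 1) - 1 = m + l by omega, mul_pow (1 - p)]
  ring

theorem hasSum_negBinomialPMF (hk : 1 ≤ k) (hp : 0 < p) (hp1 : p ≤ 1) :
    HasSum (negBinomialPMF k p) 1 := by
  have h := hasSum_negBinomialPMF_mul_pow (p := p) (s := 1) hk
    (by rw [mul_one, Real.norm_eq_abs, abs_lt]; constructor <;> linarith)
  simpa [div_self hp.ne'] using h

/-- Markov's inequality for the generating function: `1 ≤ s ^ m / s ^ M` on the tail `m ≥ M`. -/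
theorem one_sub_le_sum_negBinomialPMF (hk : 1 ≤ k) (hp : 0 < p) (hp1 : p ≤ 1) (hs : 1 ≤ s)
    (hs1 : (1 - p) * s < 1) (M : ℕ) :
    1 - (p * s / (1 - (1 - p) * s)) ^ k / s ^ M ≤
      ∑ m ∈ Finset.range M, negBinomialPMF k p m := by
  have h0 : 0 ≤ (1 - p) * s := mul_nonneg (by linarith) (by linarith)
  have h1 := (hasSum_negBinomialPMF_mul_pow (p := p) (s := s) hk
    (by rwa [Real.norm_of_nonneg h0])).div_const (s ^ M)
  have h2 := hasSum_sum_of_ne_finset_zero (L := SummationFilter.unconditional ℕ)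
    (f := fun m => if m ∈ Finset.range M then negBinomialPMF k p m else 0)
    (s := Finset.range M) (fun b hb => if_neg hb)
  rw [Finset.sum_congr rfl (fun m hm => if_pos hm)] at h2
  have h3 := hasSum_le (fun m => ?_) ((hasSum_negBinomialPMF hk hp hp1).sub h2) h1
  · linarith
  · have hf := negBinomialPMF_nonneg (k := k) hp.le hp1 m
    have hsM : 0 < s ^ M := by positivity
    split_ifs with hm
    · rw [sub_self]
      positivity
    · rw [sub_zero, le_div_iff₀ hsM]
      exact mul_le_mul_of_nonneg_left (pow_le_pow_right₀ hs (by simpa using hm)) hf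

/-- The same argument for the lower tail: with `s ≤ 1`, `1 ≤ s ^ m / s ^ M` for `m ≤ M`. -/
theorem sum_negBinomialPMF_le (hk : 1 ≤ k) (hp : 0 < p) (hp1 : p ≤ 1) (hs0 : 0 < s) (hs : s ≤ 1)
    (hs1 : (1 - p) * s < 1) (M : ℕ) :
    ∑ m ∈ Finset.range (M + 1), negBinomialPMF k p m ≤
      (p * s / (1 - (1 - p) * s)) ^ k / s ^ M := by
  have h0 : 0 ≤ (1 - p) * s := mul_nonneg (by linarith) (by linarith)
  have h1 := (hasSum_negBinomialPMF_mul_pow (p := p) (s := s) hk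
    (by rwa [Real.norm_of_nonneg h0])).div_const (s ^ M)
  have hsM : 0 < s ^ M := by positivity
  refine le_trans (Finset.sum_le_sum fun m hm => ?_) (sum_le_hasSum (Finset.range (M + 1))
    (fun m _ => ?_) h1)
  · have hf := negBinomialPMF_nonneg (k := k) hp.le hp1 m
    rw [le_div_iff₀ hsM]
    exact mul_le_mul_of_nonneg_left
      (pow_le_pow_of_le_one hs0.le hs (by simpa [Nat.lt_succ_iff] using hm)) hf
  · have hf := negBinomialPMF_nonneg (k := k) hp.le hp1 m
    positivity

/-- Exponent `t` of the Chernoff bound for the negative binomial distribution, with its rate `ρ`. -/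
theorem eventually_negBinomial_rate (ht : q * Real.exp (t * (1 - β)) + (1 - q) * Real.exp t < 1)
    (hq : 0 < q) (hq1 : q < 1) :
    ∃ ρ ∈ Set.Ioo (0 : ℝ) 1, ∀ᶠ p in 𝓝 q, 0 < p ∧ p ≤ 1 ∧ (1 - p) * Real.exp t < 1 ∧
      ∀ k M : ℕ, t * (β * k) ≤ t * M →
        (p * Real.exp t / (1 - (1 - p) * Real.exp t)) ^ k / Real.exp t ^ M ≤ ρ ^ k := by
  have hpos : 0 < q * Real.exp (t * (1 - β)) := by positivity
  have hd : 0 < 1 - (1 - q) * Real.exp t := by linarith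
  -- `g p ^ k` is the Chernoff bound at `M = β k`. The hypothesis `ht` says `g q < 1`, and
  -- continuity carries this to `p` near `q`.
  set g : ℝ → ℝ := fun p => p * Real.exp (t * (1 - β)) / (1 - (1 - p) * Real.exp t) with hg
  have hgq : g q < 1 := by rw [hg]; dsimp only; rw [div_lt_one hd]; linarith
  have hgq0 : 0 < g q := by rw [hg]; positivity
  obtain ⟨ρ, hρ, hρ1⟩ := exists_between hgq
  have hgc : ContinuousAt g q := by
    refine ContinuousAt.div (by fun_prop) (by fun_prop) hd.ne'
  have hdc : ContinuousAt (fun p : ℝ => (1 - p) * Real.exp t) q := by fun_prop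
  refine ⟨ρ, ⟨hgq0.trans hρ, hρ1⟩, ?_⟩
  filter_upwards [hgc.eventually_lt continuousAt_const hρ,
    hdc.eventually_lt continuousAt_const (by linarith : (1 - q) * Real.exp t < 1),
    lt_mem_nhds hq, gt_mem_nhds hq1] with p h1 h2 h3 h4
  refine ⟨h3, h4.le, h2, fun k M hM => ?_⟩
  have hd' : 0 < 1 - (1 - p) * Real.exp t := by linarith
  calc (p * Real.exp t / (1 - (1 - p) * Real.exp t)) ^ k / Real.exp t ^ M
      ≤ (p * Real.exp t / (1 - (1 - p) * Real.exp t)) ^ k / Real.exp (t * β) ^ k := by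
        rw [← Real.exp_nat_mul, ← Real.exp_nat_mul]
        have hb : 0 ≤ p * Real.exp t / (1 - (1 - p) * Real.exp t) := by positivity
        refine div_le_div_of_nonneg_left (pow_nonneg hb k) (Real.exp_pos _) ?_
        exact Real.exp_le_exp.2 (by linarith)
    _ = g p ^ k := by
        rw [← div_pow, hg]
        dsimp only
        rw [mul_sub, mul_one, Real.exp_sub]
        congr 1
        field_simp
    _ ≤ ρ ^ k := by
        gcongr

/-- The function is 1 at `t = 0`, so the sign of `1 - q β` tells on which side of 0 it drops below
1: on the right for `β > 1 / q`, on the left for `β < 1 / q`. -/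
theorem hasDerivAt_negBinomial_exponent :
    HasDerivAt (fun t : ℝ => q * Real.exp (t * (1 - β)) + (1 - q) * Real.exp t)
      (1 - q * β) 0 := by
  have h := ((((hasDerivAt_id (0 : ℝ)).mul_const (1 - β)).exp).const_mul q).add
    ((Real.hasDerivAt_exp 0).const_mul (1 - q))
  refine h.congr_deriv ?_
  simp
  ring

/-- Upper tail bound for the negative binomial distribution, uniform in the success probability. -/
theorem exists_one_sub_pow_le_sum_negBinomialPMF (hq : 0 < q) (hq1 : q < 1) (hβ : 1 / q < β) :
    ∃ ρ ∈ Set.Ioo (0 : ℝ) 1, ∀ᶠ p in 𝓝 q, ∀ k M : ℕ, 1 ≤ k → β * k ≤ M →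
      1 - ρ ^ k ≤ ∑ m ∈ Finset.range M, negBinomialPMF k p m := by
  have hneg : 1 - q * β < 0 := by rw [div_lt_iff₀ hq] at hβ; linarith
  have hsl := ((hasDerivAt_iff_tendsto_slope.1
    (hasDerivAt_negBinomial_exponent (q := q) (β := β))).eventually_lt_const hneg)
  have hsl' := hsl.filter_mono (nhdsWithin_mono (0 : ℝ)
    (fun t (ht : t ∈ Set.Ioi (0 : ℝ)) => (ne_of_gt ht : t ≠ 0)))
  obtain ⟨t, h1, h2⟩ := (hsl'.and self_mem_nhdsWithin).exists
  have ht : (0 : ℝ) < t := h2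
  rw [slope_def_field, sub_zero, div_lt_iff₀ ht] at h1
  simp only [zero_mul, Real.exp_zero, mul_one] at h1
  obtain ⟨ρ, hρ, h⟩ := eventually_negBinomial_rate (t := t) (β := β) (by linarith) hq hq1
  refine ⟨ρ, hρ, h.mono fun p ⟨hp, hp1, hpt, hb⟩ k M hk hM => ?_⟩
  have := one_sub_le_sum_negBinomialPMF hk hp hp1 (Real.one_le_exp ht.le) hpt M
  have := hb k M (by gcongr)
  linarith

/-- Lower tail bound for the negative binomial distribution, uniform in the success probability. -/
theorem exists_sum_negBinomialPMF_le_pow (hq : 0 < q) (hq1 : q < 1) (hβ : β < 1 / q) :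
    ∃ ρ ∈ Set.Ioo (0 : ℝ) 1, ∀ᶠ p in 𝓝 q, ∀ k M : ℕ, 1 ≤ k → (M : ℝ) ≤ β * k →
      ∑ m ∈ Finset.range (M + 1), negBinomialPMF k p m ≤ ρ ^ k := by
  have hneg : 0 < 1 - q * β := by rw [lt_div_iff₀ hq] at hβ; linarith
  have hsl := ((hasDerivAt_iff_tendsto_slope.1
    (hasDerivAt_negBinomial_exponent (q := q) (β := β))).eventually_const_lt hneg)
  have hsl' := hsl.filter_mono (nhdsWithin_mono (0 : ℝ)
    (fun t (ht : t ∈ Set.Iio (0 : ℝ)) => (ne_of_lt ht : t ≠ 0)))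
  obtain ⟨t, h1, h2⟩ := (hsl'.and self_mem_nhdsWithin).exists
  have ht : t < 0 := h2
  rw [slope_def_field, sub_zero, lt_div_iff_of_neg ht] at h1
  simp only [zero_mul, Real.exp_zero, mul_one] at h1
  obtain ⟨ρ, hρ, h⟩ := eventually_negBinomial_rate (t := t) (β := β) (by linarith) hq hq1
  refine ⟨ρ, hρ, h.mono fun p ⟨hp, hp1, hpt, hb⟩ k M hk hM => ?_⟩
  have := sum_negBinomialPMF_le hk hp hp1 (Real.exp_pos t) (Real.exp_le_one_iff.2 ht.le) hpt M
  have := hb k M (mul_le_mul_of_nonpos_left hM ht.le)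
  linarith

end NegativeBinomial

/-- From a finite set one can select the `k` elements with the smallest values of a function. -/
theorem exists_subset_card_eq_forall_le {α : Type*} [DecidableEq α] (g : α → ℝ) (A : Finset α)
    {k : ℕ} (hk : k ≤ A.card) :
    ∃ T ⊆ A, T.card = k ∧ ∀ a ∈ T, ∀ b ∈ A, b ∉ T → g a ≤ g b := by
  induction k with
  | zero => exact ⟨∅, by simp, rfl, by simp⟩
  | succ k ih =>
    obtain ⟨T, hTA, hTk, hT⟩ := ih (by omega)
    have hne : (A \ T).Nonempty := by
      rw [← Finset.card_pos, Finset.card_sdiff_of_subset hTA]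
      omega
    obtain ⟨c, hc, hcmin⟩ := (A \ T).exists_min_image g hne
    rw [Finset.mem_sdiff] at hc
    refine ⟨insert c T, Finset.insert_subset hc.1 hTA, ?_, ?_⟩
    · rw [Finset.card_insert_of_notMem hc.2, hTk]
    · intro a ha b hb hbT
      rw [Finset.mem_insert, not_or] at hbT
      rcases Finset.mem_insert.1 ha with rfl | ha
      · exact hcmin b (Finset.mem_sdiff.2 ⟨hb, hbT.2⟩)
      · exact hT a ha b hb hbT.2

/-! ### Deterministic comparison of `N_k(x)` with ball counts -/

section Neighbors

variable {E : Type*} [PseudoMetricSpace E] {s : Fin 2 → ℕ} {x : E} {z : SampleIdx s → E}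
  {k l M : ℕ} {r : ℝ}

/-- The number of observations of class `i` in the open ball of radius `r` around `x`. -/
noncomputable def ballCount (x : E) (z : SampleIdx s → E) (r : ℝ) (i : Fin 2) : ℕ :=
  (Finset.univ.filter fun a : SampleIdx s => a.1 = i ∧ dist (z a) x < r).card

theorem card_filter_fst_eq (i : Fin 2) :
    (Finset.univ.filter fun a : SampleIdx s => a.1 = i).card = s i := by
  rw [show (Finset.univ.filter fun a : SampleIdx s => a.1 = i) =
    Finset.univ.map (Function.Embedding.sigmaMk i) from ?_, Finset.card_map, Finset.card_fin]
  ext ⟨j, y⟩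
  simp only [Finset.mem_filter, Finset.mem_univ, true_and, Finset.mem_map,
    Function.Embedding.sigmaMk_apply]
  constructor
  · rintro rfl
    exact ⟨y, rfl⟩
  · rintro ⟨y, h⟩
    exact (congrArg Sigma.fst h).symm

theorem neighborsNeeded_le_card {S : Finset (SampleIdx s)} (hS : IsNeighborSet x z S)
    (hk : k ≤ (S.filter (fun a => a.1 = 1)).card) : neighborsNeeded x z k ≤ S.card :=
  Nat.sInf_le ⟨S, hS, rfl, hk⟩

theorem exists_card_eq_neighborsNeeded (hk : k ≤ s 1) :
    ∃ S : Finset (SampleIdx s), IsNeighborSet x z S ∧ S.card = neighborsNeeded x z k ∧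
      k ≤ (S.filter (fun a => a.1 = 1)).card :=
  Nat.sInf_mem (s := {m : ℕ | ∃ S : Finset (SampleIdx s), IsNeighborSet x z S ∧ S.card = m ∧
    k ≤ (S.filter (fun a => a.1 = 1)).card})
    ⟨_, Finset.univ, fun _ _ b hb => absurd (Finset.mem_univ b) hb, rfl,
      hk.trans_eq (card_filter_fst_eq 1).symm⟩

theorem le_neighborsNeeded (hk : k ≤ s 1) : k ≤ neighborsNeeded x z k := by
  obtain ⟨S, _, hc, hS⟩ := exists_card_eq_neighborsNeeded (x := x) (z := z) hk
  exact hc ▸ hS.trans (Finset.card_filter_le _ _)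

theorem neighborsNeeded_mono (hkl : k ≤ l) (hl : l ≤ s 1) :
    neighborsNeeded x z k ≤ neighborsNeeded x z l := by
  obtain ⟨S, hS, hc, hSl⟩ := exists_card_eq_neighborsNeeded (x := x) (z := z) hl
  exact (neighborsNeeded_le_card hS (hkl.trans hSl)).trans_eq hc

/-- A neighbor set with `k` minority points must then contain one at distance at least `r`, hence
also every majority point of the ball. -/
theorem add_ballCount_le_neighborsNeeded (hk : k ≤ s 1) (h : ballCount x z r 1 < k) :
    k + ballCount x z r 0 ≤ neighborsNeeded x z k := by
  classical
  obtain ⟨S, hS, hc, hSk⟩ := exists_card_eq_neighborsNeeded (x := x) (z := z) hk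
  have hlt := h.trans_le hSk
  obtain ⟨a, haS, ha⟩ := Finset.exists_mem_notMem_of_card_lt_card hlt
  simp only [Finset.mem_filter, Finset.mem_univ, true_and, not_and, not_lt] at haS ha
  have har := ha haS.2
  rw [← hc, ← Finset.card_filter_add_card_filter_not (s := S) (fun a => a.1 = 1)]
  refine add_le_add hSk (Finset.card_le_card fun b hb => ?_)
  simp only [Finset.mem_filter, Finset.mem_univ, true_and] at hb ⊢
  refine ⟨?_, by simp [hb.1]⟩
  by_contra hbS
  have := hS a haS.1 b hbS
  linarith [hb.2]

/-- The `k` nearest minority points, together with the majority points strictly closer than one of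
them, form a neighbor set, and all of these lie in the ball. -/
theorem neighborsNeeded_le_add_ballCount (h : k ≤ ballCount x z r 1) :
    neighborsNeeded x z k ≤ k + ballCount x z r 0 := by
  classical
  obtain ⟨T, hTA, hTk, hT⟩ := exists_subset_card_eq_forall_le (fun a => dist (z a) x) _ h
  have hTm : ∀ a ∈ T, a.1 = 1 ∧ dist (z a) x < r := fun a ha => by simpa using hTA ha
  set U : Finset (SampleIdx s) :=
    Finset.univ.filter fun b => b.1 = 0 ∧ ∃ a ∈ T, dist (z b) x < dist (z a) x with hU
  have hmin : ∀ a ∈ T, ∀ b : SampleIdx s, b ∉ T ∪ U → dist (z a) x ≤ dist (z b) x := by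
    intro a ha b hb
    rw [Finset.mem_union, not_or] at hb
    by_cases hb1 : b.1 = 0
    · by_contra! hlt
      exact hb.2 (Finset.mem_filter.2 ⟨Finset.mem_univ b, hb1, a, ha, hlt⟩)
    · by_cases hbr : dist (z b) x < r
      · exact hT a ha b (by simpa using ⟨by omega, hbr⟩) hb.1
      · linarith [(hTm a ha).2]
  have hS : IsNeighborSet x z (T ∪ U) := by
    intro a ha b hb
    rcases Finset.mem_union.1 ha with ha | ha
    · exact hmin a ha b hb
    · obtain ⟨-, -, c, hc, hac⟩ := by simpa only [hU, Finset.mem_filter] using ha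
      exact hac.le.trans (hmin c hc b hb)
  refine (neighborsNeeded_le_card hS ?_).trans ((Finset.card_union_le _ _).trans
    (add_le_add hTk.le (Finset.card_le_card fun b hb => ?_)))
  · rw [← hTk]
    refine Finset.card_le_card fun a ha => ?_
    rw [Finset.mem_filter, Finset.mem_union]
    exact ⟨Or.inl ha, (hTm a ha).1⟩
  · obtain ⟨-, hb0, c, hc, hbc⟩ := by simpa only [hU, Finset.mem_filter] using hb
    simpa using ⟨hb0, hbc.trans (hTm c hc).2⟩

end Neighbors

/-! ### Evidence bounds that force a decision -/

section Decision

variable {E : Type*} [PseudoMetricSpace E] {s : Fin 2 → ℕ} {x : E} {z : SampleIdx s → E}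
  {k k₀ K : ℕ} {η ρ β : ℝ}

theorem assignedTo_zero_of_le_evidence (hK : 1 ≤ K) (hη : ∀ k ∈ Finset.Icc 1 K, η ≤ evidence x z k)
    (h : 1 - η < evidence x z K) : AssignedTo x z K 0 := by
  rw [AssignedTo, if_pos rfl, strongestEvidence₁, strongestEvidence₂]
  have : Nonempty (Finset.Icc 1 K) := ⟨⟨K, by simpa using hK⟩⟩
  have h1 : η ≤ ⨅ k : Finset.Icc 1 K, evidence x z (k : ℕ) := le_ciInf fun k => hη k k.2
  have h2 := le_ciSup (f := fun k : Finset.Icc 1 K => evidence x z (k : ℕ))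
    (Set.finite_range _).bddAbove ⟨K, by simpa using hK⟩
  dsimp only at h2
  linarith

theorem assignedTo_one_of_evidence_le (hK : 1 ≤ K)
    (hη : ∀ k ∈ Finset.Icc 1 K, evidence x z k ≤ 1 - η)
    (h : evidence x z K < η) : AssignedTo x z K 1 := by
  rw [AssignedTo, if_neg one_ne_zero, strongestEvidence₁, strongestEvidence₂]
  have : Nonempty (Finset.Icc 1 K) := ⟨⟨K, by simpa using hK⟩⟩
  have h1 : ⨆ k : Finset.Icc 1 K, evidence x z (k : ℕ) ≤ 1 - η := ciSup_le fun k => hη k k.2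
  have h2 := ciInf_le (f := fun k : Finset.Icc 1 K => evidence x z (k : ℕ))
    (Set.finite_range _).bddBelow ⟨K, by simpa using hK⟩
  dsimp only at h2
  linarith

theorem sum_range_le_evidence (h0 : 0 ≤ minorityProportion s) (h1 : minorityProportion s ≤ 1) :
    ∑ m ∈ Finset.range (neighborsNeeded x z k), negBinomialPMF k (minorityProportion s) m ≤
      evidence x z k := by
  rw [evidence]
  linarith [negBinomialPMF_nonneg (k := k) h0 h1 (neighborsNeeded x z k)]

theorem evidence_eq_sum_range_succ_sub :
    evidence x z k = ∑ m ∈ Finset.range (neighborsNeeded x z k + 1),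
      negBinomialPMF k (minorityProportion s) m -
        1 / 2 * negBinomialPMF k (minorityProportion s) (neighborsNeeded x z k) := by
  rw [evidence, Finset.sum_range_succ]
  ring

/-- Since `N_k(x) ≥ k`, the mass at `m = k` always enters with weight at least one half. The bound
holds for every sample, which settles small `k`. -/
theorem pow_div_two_le_evidence (h0 : 0 ≤ minorityProportion s) (h1 : minorityProportion s ≤ 1)
    (hk : k ≤ s 1) : minorityProportion s ^ k / 2 ≤ evidence x z k := by
  have hpmf : negBinomialPMF k (minorityProportion s) k = minorityProportion s ^ k := by
    simp [negBinomialPMF]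
  have hpos : 0 ≤ minorityProportion s ^ k := by positivity
  rcases (le_neighborsNeeded (x := x) (z := z) hk).eq_or_lt with h | h
  · rw [evidence, ← h, hpmf]
    linarith [Finset.sum_nonneg fun m (_ : m ∈ Finset.range k) =>
      negBinomialPMF_nonneg (k := k) h0 h1 m]
  · refine le_trans ?_ (sum_range_le_evidence h0 h1)
    have := Finset.single_le_sum (f := negBinomialPMF k (minorityProportion s))
      (fun m _ => negBinomialPMF_nonneg h0 h1 m) (Finset.mem_range.2 h)
    linarith

/-- Half of the mass at `N_k(x)` is left out of the evidence, and its binomial coefficient is at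
least 1. -/
theorem evidence_le_one_sub (h0 : 0 < minorityProportion s) (h1 : minorityProportion s ≤ 1)
    (hk : 1 ≤ k) (hks : k ≤ s 1) :
    evidence x z k ≤ 1 - minorityProportion s ^ k *
      (1 - minorityProportion s) ^ neighborsNeeded x z k / 2 := by
  have hle := le_neighborsNeeded (x := x) (z := z) hks
  have hsum := sum_le_hasSum (Finset.range (neighborsNeeded x z k + 1))
    (fun m _ => negBinomialPMF_nonneg h0.le h1 m) (hasSum_negBinomialPMF hk h0 h1)
  have hq : 0 ≤ 1 - minorityProportion s := by linarith
  have hpmf : minorityProportion s ^ k * (1 - minorityProportion s) ^ neighborsNeeded x z k ≤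
      negBinomialPMF k (minorityProportion s) (neighborsNeeded x z k) := by
    rw [negBinomialPMF, if_pos hle]
    have hc : (1 : ℝ) ≤ ((neighborsNeeded x z k - 1).choose (k - 1) : ℝ) := by
      exact_mod_cast Nat.choose_pos (by omega)
    refine mul_le_mul (le_mul_of_one_le_left (by positivity) hc)
      (pow_le_pow_of_le_one hq (by linarith) (Nat.sub_le _ _)) (by positivity) (by positivity)
  rw [evidence_eq_sum_range_succ_sub]
  linarith

end Decision

/-! ### Chernoff bounds for the number of points in a set -/

section Chernoff

variable {Ω E ι : Type*} [MeasurableSpace Ω] [MeasurableSpace E] {P : Measure Ω}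
  [IsProbabilityMeasure P] {Y : ι → Ω → E} {B : Set E} {S : Finset ι} {θ y : ℝ}

theorem mgf_indicator_comp {Y : Ω → E} (hY : AEMeasurable Y P) (hB : MeasurableSet B) (t : ℝ) :
    mgf (B.indicator 1 ∘ Y) P t = 1 + (Real.exp t - 1) * P.real (Y ⁻¹' B) := by
  have hn : NullMeasurableSet (Y ⁻¹' B) P := hY.nullMeasurableSet_preimage hB
  have h : (fun ω => Real.exp (t * (B.indicator (1 : E → ℝ) ∘ Y) ω)) =
      fun ω => 1 + (Y ⁻¹' B).indicator (fun _ => Real.exp t - 1) ω := by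
    ext ω
    by_cases hω : Y ω ∈ B
    · simp [hω]
    · simp [hω]
  rw [mgf, h, integral_add (integrable_const _) ((integrable_const _).indicator₀ hn),
    integral_indicator₀ hn]
  simp [mul_comm]

/-- By `1 + u ≤ exp u`, each Bernoulli factor is dominated by a Poisson one, so only the total
expectation matters. -/
theorem mgf_sum_indicator_comp_le (hY : ∀ i, AEMeasurable (Y i) P) (hind : iIndepFun Y P)
    (hB : MeasurableSet B) (t : ℝ) :
    mgf (∑ i ∈ S, B.indicator (1 : E → ℝ) ∘ Y i) P t ≤
      Real.exp ((Real.exp t - 1) * ∑ i ∈ S, P.real (Y i ⁻¹' B)) := by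
  have hm : Measurable (B.indicator (1 : E → ℝ)) := measurable_one.indicator hB
  rw [(hind.comp (fun _ => B.indicator (1 : E → ℝ)) (fun _ => hm)).mgf_sum₀
    (fun i => hm.comp_aemeasurable (hY i)), Finset.mul_sum, Real.exp_sum]
  refine Finset.prod_le_prod (fun i _ => mgf_nonneg) fun i _ => ?_
  rw [mgf_indicator_comp (hY i) hB, add_comm]
  exact Real.add_one_le_exp _

theorem integrable_exp_mul_sum_indicator_comp (hY : ∀ i, AEMeasurable (Y i) P)
    (hB : MeasurableSet B) (t : ℝ) :
    Integrable (fun ω => Real.exp (t * (∑ i ∈ S, B.indicator (1 : E → ℝ) ∘ Y i) ω)) P := by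
  have hm : Measurable (B.indicator (1 : E → ℝ)) := measurable_one.indicator hB
  have hs : AEMeasurable (∑ i ∈ S, B.indicator (1 : E → ℝ) ∘ Y i) P :=
    Finset.aemeasurable_sum _ fun i _ => hm.comp_aemeasurable (hY i)
  refine Integrable.of_bound (C := Real.exp (|t| * S.card))
    (hs.const_mul t).exp.aestronglyMeasurable (ae_of_all _ fun ω => ?_)
  rw [Real.norm_of_nonneg (Real.exp_pos _).le, Real.exp_le_exp]
  have h1 : ∀ i ∈ S, (B.indicator (1 : E → ℝ) ∘ Y i) ω ≤ 1 := fun i _ =>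
    Set.indicator_le_self' (fun _ _ => zero_le_one) _
  have h0 : ∀ i ∈ S, 0 ≤ (B.indicator (1 : E → ℝ) ∘ Y i) ω := fun i _ =>
    Set.indicator_nonneg (fun _ _ => zero_le_one) _
  rw [Finset.sum_apply]
  refine mul_le_mul (le_abs_self t) ?_ (Finset.sum_nonneg h0) (abs_nonneg t)
  simpa using Finset.sum_le_sum h1

theorem measureReal_ge_sum_indicator_comp_le (hY : ∀ i, AEMeasurable (Y i) P)
    (hind : iIndepFun Y P) (hB : MeasurableSet B) (hθ : 0 < θ) (hθ1 : θ ≤ 1)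
    (hy : ∑ i ∈ S, P.real (Y i ⁻¹' B) ≤ θ * y) :
    P.real {ω | y ≤ (∑ i ∈ S, B.indicator (1 : E → ℝ) ∘ Y i) ω} ≤
      Real.exp (y * (Real.log θ + 1 - θ)) := by
  -- The parameter `-log θ` is optimal for a Poisson variable of mean `θ y`.
  have ht : 0 ≤ -Real.log θ := neg_nonneg.2 (Real.log_nonpos hθ.le hθ1)
  refine (measure_ge_le_exp_mul_mgf y ht
    (integrable_exp_mul_sum_indicator_comp hY hB _)).trans ?_
  refine (mul_le_mul_of_nonneg_left (mgf_sum_indicator_comp_le hY hind hB _)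
    (Real.exp_pos _).le).trans ?_
  rw [← Real.exp_add, Real.exp_le_exp, Real.exp_neg, Real.exp_log hθ]
  have h := mul_le_mul_of_nonneg_left hy (sub_nonneg.2 ((one_le_inv₀ hθ).2 hθ1))
  have h2 : (θ⁻¹ - 1) * (θ * y) = (1 - θ) * y := by field_simp
  linarith

theorem measureReal_le_sum_indicator_comp_le (hY : ∀ i, AEMeasurable (Y i) P)
    (hind : iIndepFun Y P) (hB : MeasurableSet B) (hθ1 : 1 ≤ θ)
    (hy : θ * y ≤ ∑ i ∈ S, P.real (Y i ⁻¹' B)) :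
    P.real {ω | (∑ i ∈ S, B.indicator (1 : E → ℝ) ∘ Y i) ω ≤ y} ≤
      Real.exp (y * (Real.log θ + 1 - θ)) := by
  have hθ : 0 < θ := by linarith
  have ht : -Real.log θ ≤ 0 := neg_nonpos.2 (Real.log_nonneg hθ1)
  refine (measure_le_le_exp_mul_mgf y ht
    (integrable_exp_mul_sum_indicator_comp hY hB _)).trans ?_
  refine (mul_le_mul_of_nonneg_left (mgf_sum_indicator_comp_le hY hind hB _)
    (Real.exp_pos _).le).trans ?_
  rw [← Real.exp_add, Real.exp_le_exp, Real.exp_neg, Real.exp_log hθ]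
  have h := mul_le_mul_of_nonpos_left hy (sub_nonpos.2 (inv_le_one_of_one_le₀ hθ1))
  have h2 : (θ⁻¹ - 1) * (θ * y) = (1 - θ) * y := by field_simp
  linarith

end Chernoff

/-! ### Chernoff bounds for ball counts -/

section BallCount

variable {Ω E : Type*} [PseudoMetricSpace E] {s : Fin 2 → ℕ} {X : SampleIdx s → Ω → E} {x : E}
  {r θ y : ℝ} {i : Fin 2}

theorem ballCount_eq_sum_indicator (ω : Ω) :
    (ballCount x (fun a => X a ω) r i : ℝ) =
      (∑ a : SampleIdx s with a.1 = i, (Metric.ball x r).indicator (1 : E → ℝ) ∘ X a) ω := by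
  classical
  rw [ballCount, ← Finset.filter_filter, Finset.sum_apply, Finset.card_filter, Nat.cast_sum]
  refine Finset.sum_congr rfl fun a _ => ?_
  simp [Set.indicator_apply]

variable [MeasurableSpace Ω] [MeasurableSpace E] [OpensMeasurableSpace E] {P : Measure Ω}
  {μ : Fin 2 → Measure E}

theorem sum_measureReal_preimage_ball (hlaw : ∀ a, HasLaw (X a) (μ a.1) P) :
    ∑ a : SampleIdx s with a.1 = i, P.real (X a ⁻¹' Metric.ball x r) =
      s i * (μ i).real (Metric.ball x r) := by
  rw [← card_filter_fst_eq (s := s) i, ← nsmul_eq_mul]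
  refine Finset.sum_eq_card_nsmul fun a ha => ?_
  rw [← (Finset.mem_filter.1 ha).2, measureReal_def, measureReal_def, ← (hlaw a).map_eq,
    Measure.map_apply_of_aemeasurable (hlaw a).aemeasurable Metric.isOpen_ball.measurableSet]

variable [IsProbabilityMeasure P]

theorem measureReal_ballCount_ge_le (hlaw : ∀ a, HasLaw (X a) (μ a.1) P) (hind : iIndepFun X P)
    (hθ : 0 < θ) (hθ1 : θ ≤ 1) (hy : s i * (μ i).real (Metric.ball x r) ≤ θ * y) :
    P.real {ω | y ≤ ballCount x (fun a => X a ω) r i} ≤ Real.exp (y * (Real.log θ + 1 - θ)) := by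
  simp_rw [ballCount_eq_sum_indicator]
  exact measureReal_ge_sum_indicator_comp_le (fun a => (hlaw a).aemeasurable) hind
    Metric.isOpen_ball.measurableSet hθ hθ1 ((sum_measureReal_preimage_ball hlaw).trans_le hy)

theorem measureReal_ballCount_le_le (hlaw : ∀ a, HasLaw (X a) (μ a.1) P) (hind : iIndepFun X P)
    (hθ1 : 1 ≤ θ) (hy : θ * y ≤ s i * (μ i).real (Metric.ball x r)) :
    P.real {ω | (ballCount x (fun a => X a ω) r i : ℝ) ≤ y} ≤
      Real.exp (y * (Real.log θ + 1 - θ)) := by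
  simp_rw [ballCount_eq_sum_indicator]
  exact measureReal_le_sum_indicator_comp_le (fun a => (hlaw a).aemeasurable) hind
    Metric.isOpen_ball.measurableSet hθ1 (hy.trans_eq (sum_measureReal_preimage_ball hlaw).symm)

end BallCount

/-! ### Small balls under a continuous density -/

section Density

variable {d : ℕ} {x : EuclideanSpace ℝ (Fin d)} {f g : EuclideanSpace ℝ (Fin d) → ℝ}
  {a b c r v : ℝ}

theorem exists_volume_real_ball_eq (hd : d ≠ 0) (hv : 0 ≤ v)
    (hvr : v < volume.real (Metric.ball x r)) :
    ∃ r' ≤ r, volume.real (Metric.ball x r') = v := by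
  have : Nonempty (Fin d) := ⟨⟨0, Nat.pos_of_ne_zero hd⟩⟩
  set V : ℝ := volume.real (Metric.ball (0 : EuclideanSpace ℝ (Fin d)) 1) with hV
  have hV0 : 0 < V := ENNReal.toReal_pos (Metric.measure_ball_pos _ _ one_pos).ne'
    measure_ball_lt_top.ne
  have hb : 0 ≤ v / V := by positivity
  have hball : volume.real (Metric.ball x ((v / V) ^ (d : ℝ)⁻¹)) = v := by
    rw [measureReal_def, Measure.addHaar_ball _ _ (Real.rpow_nonneg hb _), ENNReal.toReal_mul,
      finrank_euclideanSpace_fin, Real.rpow_inv_natCast_pow hb hd, ENNReal.toReal_ofReal hb,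
      ← measureReal_def, ← hV, div_mul_cancel₀ _ hV0.ne']
  refine ⟨_, ?_, hball⟩
  by_contra! h
  have := measureReal_mono (μ := volume) (Metric.ball_subset_ball (x := x) h.le)
    measure_ball_lt_top.ne
  linarith

theorem exists_measureReal_ball_le (hf : Continuous f) (hb0 : 0 ≤ b)
    (hb : f x < b) :
    ∃ r > 0, ∀ r' ≤ r, (volume.withDensity fun y => ENNReal.ofReal (f y)).real (Metric.ball x r') ≤
      b * volume.real (Metric.ball x r') := by
  obtain ⟨r, hr, h⟩ := Metric.eventually_nhds_iff_ball.1
    (hf.continuousAt.eventually_lt continuousAt_const hb)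
  refine ⟨r, hr, fun r' hr' => ?_⟩
  rw [measureReal_def, measureReal_def, withDensity_apply _ measurableSet_ball,
    ← ENNReal.toReal_ofReal hb0, ← ENNReal.toReal_mul]
  refine ENNReal.toReal_mono (ENNReal.mul_ne_top ENNReal.ofReal_ne_top measure_ball_lt_top.ne) ?_
  rw [← setLIntegral_const]
  exact setLIntegral_mono measurable_const fun y hy =>
    ENNReal.ofReal_le_ofReal (h y (Metric.ball_subset_ball hr' hy)).le

theorem exists_le_measureReal_ball (hf : Continuous f) (hfi : Integrable f) (ha0 : 0 ≤ a)
    (ha : a < f x) :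
    ∃ r > 0, ∀ r' ≤ r, a * volume.real (Metric.ball x r') ≤
      (volume.withDensity fun y => ENNReal.ofReal (f y)).real (Metric.ball x r') := by
  have := isFiniteMeasure_withDensity_ofReal hfi.2
  obtain ⟨r, hr, h⟩ := Metric.eventually_nhds_iff_ball.1
    (continuousAt_const.eventually_lt hf.continuousAt ha)
  refine ⟨r, hr, fun r' hr' => ?_⟩
  rw [measureReal_def, measureReal_def, ← ENNReal.toReal_ofReal ha0, ← ENNReal.toReal_mul]
  refine ENNReal.toReal_mono (measure_ne_top _ _) ?_
  rw [← setLIntegral_const,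
    withDensity_apply _ measurableSet_ball]
  exact setLIntegral_mono (by fun_prop) fun y hy =>
    ENNReal.ofReal_le_ofReal (h y (Metric.ball_subset_ball hr' hy)).le

/-- Parametrizing balls by volume instead of radius lets one ball serve both densities, with masses
linear in `v`. -/
theorem exists_measureReal_ball_le_and_le (hd : d ≠ 0) (hf : Continuous f) (hfi : Integrable f)
    (hg : Continuous g) (ha0 : 0 ≤ a) (hb0 : 0 ≤ b) (ha : a < f x)
    (hb : g x < b) :
    ∃ v₀ > 0, ∀ v, 0 ≤ v → v < v₀ → ∃ r : ℝ,
      a * v ≤ (volume.withDensity fun y => ENNReal.ofReal (f y)).real (Metric.ball x r) ∧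
      (volume.withDensity fun y => ENNReal.ofReal (g y)).real (Metric.ball x r) ≤ b * v := by
  obtain ⟨r₁, hr₁, h₁⟩ := exists_le_measureReal_ball hf hfi ha0 ha
  obtain ⟨r₂, hr₂, h₂⟩ := exists_measureReal_ball_le hg hb0 hb
  refine ⟨volume.real (Metric.ball x (min r₁ r₂)), ENNReal.toReal_pos
    (Metric.measure_ball_pos _ _ (lt_min hr₁ hr₂)).ne' measure_ball_lt_top.ne, fun v hv hv' => ?_⟩
  obtain ⟨r, hr, rfl⟩ := exists_volume_real_ball_eq hd hv hv'
  exact ⟨r, h₁ r (hr.trans (min_le_left _ _)), h₂ r (hr.trans (min_le_right _ _))⟩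

/-- Rules out dimension 0, where balls of prescribed volume need not exist: on a one-point space the
normalization determines the density. -/
theorem eq_of_integral_eq_one_of_dim_zero {f g : EuclideanSpace ℝ (Fin 0) → ℝ}
    (hf : ∫ y, f y = 1) (hg : ∫ y, g y = 1) (x : EuclideanSpace ℝ (Fin 0)) : f x = g x := by
  have hc : ∀ h : EuclideanSpace ℝ (Fin 0) → ℝ, ∫ y, h y =
      volume.real (Set.univ : Set (EuclideanSpace ℝ (Fin 0))) * h x := fun h => by
    rw [show h = fun _ => h x from funext fun y => congrArg h (Subsingleton.elim y x),
      integral_const, smul_eq_mul]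
  rw [hc] at hf hg
  exact mul_left_cancel₀ (left_ne_zero_of_mul_eq_one hf) (hf.trans hg.symm)

end Density

/-! ### Deviation bounds for `N_k(x)` at fixed `n` and `k` -/

section NeighborConcentration

variable {Ω E : Type*} [MeasurableSpace Ω] [PseudoMetricSpace E] [MeasurableSpace E]
  [OpensMeasurableSpace E] {P : Measure Ω} [IsProbabilityMeasure P] {s : Fin 2 → ℕ}
  {X : SampleIdx s → Ω → E} {μ : Fin 2 → Measure E} {x : E} {r a b c c' : ℝ} {k : ℕ}

/-- In a ball of volume `k / (s 1 * c)` the expected minority count is at most `(b / c) k < k`, and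
the expected majority count at least `a / c' > 1` times `(c' / c) (s 0 / s 1) k`. A small `N_k(x)`
forces one count to deviate from its expectation. -/
theorem measureReal_neighborsNeeded_lt_le (hlaw : ∀ a, HasLaw (X a) (μ a.1) P)
    (hind : iIndepFun X P) (hs : 0 < s 1) (hk : k ≤ s 1) (hb : 0 < b) (hbc : b < c) (hcc : c < c')
    (hca : c' < a) (h1 : (μ 1).real (Metric.ball x r) ≤ b * (k / (s 1 * c)))
    (h0 : a * (k / (s 1 * c)) ≤ (μ 0).real (Metric.ball x r)) :
    P.real {ω | (neighborsNeeded x (fun a => X a ω) k : ℝ) < (1 + c' / c * (s 0 / s 1)) * k} ≤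
      Real.exp (k * (Real.log (b / c) + 1 - b / c)) +
        Real.exp (c' / c * (s 0 / s 1) * k * (Real.log (a / c') + 1 - a / c')) := by
  have hs' : (0 : ℝ) < s 1 := by exact_mod_cast hs
  have hc : 0 < c := hb.trans hbc
  have hc' : 0 < c' := hc.trans hcc
  refine le_trans (measureReal_mono ?_) ((measureReal_union_le _ _).trans (add_le_add
    (measureReal_ballCount_ge_le (i := 1) (r := r) (x := x) hlaw hind (div_pos hb hc)
      ((div_le_one hc).2 hbc.le) ?_)
    (measureReal_ballCount_le_le (i := 0) (r := r) (x := x) hlaw hind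
      ((one_le_div hc').2 hca.le) ?_)))
  · intro ω hω
    rw [Set.mem_ofPred_eq] at hω
    by_cases h : k ≤ ballCount x (fun a => X a ω) r 1
    · exact Or.inl (by simpa using h)
    · have hN : ((k + ballCount x (fun a => X a ω) r 0 : ℕ) : ℝ) ≤ _ :=
        Nat.cast_le.2 (add_ballCount_le_neighborsNeeded hk (not_le.1 h))
      push_cast at hN
      right
      rw [Set.mem_ofPred_eq]
      linarith
  · refine (mul_le_mul_of_nonneg_left h1 hs'.le).trans_eq ?_
    field_simp
  · refine le_trans (Eq.le ?_) (mul_le_mul_of_nonneg_left h0 (Nat.cast_nonneg (s 0)))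
    field_simp

theorem measureReal_lt_neighborsNeeded_le (hlaw : ∀ a, HasLaw (X a) (μ a.1) P)
    (hind : iIndepFun X P) (hs : 0 < s 1) (hb : 0 < b) (hbc : b < c') (hcc : c' < c)
    (hca : c < a) (h1 : a * (k / (s 1 * c)) ≤ (μ 1).real (Metric.ball x r))
    (h0 : (μ 0).real (Metric.ball x r) ≤ b * (k / (s 1 * c))) :
    P.real {ω | (1 + c' / c * (s 0 / s 1)) * k < (neighborsNeeded x (fun a => X a ω) k : ℝ)} ≤
      Real.exp (k * (Real.log (a / c) + 1 - a / c)) +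
        Real.exp (c' / c * (s 0 / s 1) * k * (Real.log (b / c') + 1 - b / c')) := by
  have hs' : (0 : ℝ) < s 1 := by exact_mod_cast hs
  have hc' : 0 < c' := hb.trans hbc
  have hc : 0 < c := hc'.trans hcc
  refine le_trans (measureReal_mono ?_) ((measureReal_union_le _ _).trans (add_le_add
    (measureReal_ballCount_le_le (i := 1) (r := r) (x := x) hlaw hind
      ((one_le_div hc).2 hca.le) ?_)
    (measureReal_ballCount_ge_le (i := 0) (r := r) (x := x) hlaw hind (div_pos hb hc')
      ((div_le_one hc').2 hbc.le) ?_)))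
  · intro ω hω
    rw [Set.mem_ofPred_eq] at hω
    by_cases h : ballCount x (fun a => X a ω) r 1 ≤ k
    · exact Or.inl (by simpa using h)
    · have hN : _ ≤ ((k + ballCount x (fun a => X a ω) r 0 : ℕ) : ℝ) :=
        Nat.cast_le.2 (neighborsNeeded_le_add_ballCount (not_le.1 h).le)
      push_cast at hN
      right
      rw [Set.mem_ofPred_eq]
      linarith
  · refine le_trans (Eq.le ?_) (mul_le_mul_of_nonneg_left h1 hs'.le)
    field_simp
  · refine (mul_le_mul_of_nonneg_left h0 (Nat.cast_nonneg (s 0))).trans_eq ?_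
    field_simp

end NeighborConcentration

theorem log_add_one_sub_neg {θ : ℝ} (hθ : 0 < θ) (hθ1 : θ ≠ 1) : Real.log θ + 1 - θ < 0 := by
  linarith [Real.log_lt_sub_one_of_pos hθ hθ1]

/-- Two exponential bounds with negative rates are dominated by a common geometric one. -/
theorem exists_exp_add_exp_le_two_mul_pow {κ₁ κ₂ u : ℝ} (h₁ : κ₁ < 0) (h₂ : κ₂ < 0) (hu : 0 < u) :
    ∃ ρ ∈ Set.Ioo (0 : ℝ) 1, ∀ (k : ℕ) (w : ℝ), u ≤ w →
      Real.exp (k * κ₁) + Real.exp (w * k * κ₂) ≤ 2 * ρ ^ k := by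
  refine ⟨Real.exp (max κ₁ (u * κ₂)), ⟨Real.exp_pos _, Real.exp_lt_one_iff.2
    (max_lt h₁ (mul_neg_of_pos_of_neg hu h₂))⟩, fun k w hw => ?_⟩
  rw [← Real.exp_nat_mul, two_mul]
  refine add_le_add (Real.exp_le_exp.2 ?_) (Real.exp_le_exp.2 ?_)
  · exact mul_le_mul_of_nonneg_left (le_max_left _ _) (Nat.cast_nonneg k)
  · calc w * k * κ₂ = k * (w * κ₂) := by ring
      _ ≤ k * max κ₁ (u * κ₂) := mul_le_mul_of_nonneg_left
        ((mul_le_mul_of_nonpos_right hw h₂.le).trans (le_max_right _ _)) (Nat.cast_nonneg k)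

/-- A union bound: if the `k`-th bad event has geometrically small probability, and avoiding the
bad events from any fixed index on eventually forces `A n`, then `A n` has probability tending
to one. -/
theorem tendsto_measure_one_of_forall_notMem {Ω : Type*} [MeasurableSpace Ω] {P : Measure Ω}
    [IsProbabilityMeasure P] {A : ℕ → Set Ω} {B : ℕ → ℕ → Set Ω} {K : ℕ → ℕ} {ρ : ℝ}
    (hρ : ρ ∈ Set.Ioo (0 : ℝ) 1)
    (hB : ∀ᶠ n in atTop, ∀ k, 1 ≤ k → k ≤ K n → P.real (B n k) ≤ 2 * ρ ^ k)
    (hA : ∀ k₀, 1 ≤ k₀ → ∀ᶠ n in atTop, ∀ ω, (∀ k, k₀ ≤ k → k ≤ K n → ω ∉ B n k) → ω ∈ A n) :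
    Tendsto (fun n => P (A n)) atTop (𝓝 1) := by
  have hρ1 : 0 < 1 - ρ := by linarith [hρ.2]
  refine (ENNReal.tendsto_toReal_iff (fun n => measure_ne_top P _) ENNReal.one_ne_top).1 ?_
  rw [ENNReal.toReal_one]
  refine tendsto_order.2 ⟨fun y hy => ?_, fun y hy => Eventually.of_forall fun n =>
    lt_of_le_of_lt measureReal_le_one hy⟩
  have hlim : Tendsto (fun k : ℕ => 2 * (ρ ^ k * (1 - ρ)⁻¹)) atTop (𝓝 0) := by
    simpa using ((tendsto_pow_atTop_nhds_zero_of_lt_one hρ.1.le hρ.2).mul_const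
      (1 - ρ)⁻¹).const_mul 2
  -- `k₀` is fixed before `n`, so that the whole geometric tail from `k₀` on is below `1 - y`.
  obtain ⟨k₀, hk₀, hk₀1⟩ :=
    ((hlim.eventually_lt_const (sub_pos.2 hy)).and (eventually_ge_atTop 1)).exists
  filter_upwards [hB, hA k₀ hk₀1] with n hBn hAn
  -- Covering the space and using subadditivity avoids complements, so `A n` and `B n k` need not be
  -- measurable.
  have hcover : (Set.univ : Set Ω) ⊆ A n ∪ ⋃ k ∈ Finset.Icc k₀ (K n), B n k := by
    intro ω _
    by_cases h : ∀ k, k₀ ≤ k → k ≤ K n → ω ∉ B n k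
    · exact Or.inl (hAn ω h)
    · push Not at h
      obtain ⟨k, h1, h2, h3⟩ := h
      exact Or.inr (Set.mem_biUnion (Finset.mem_coe.2 (Finset.mem_Icc.2 ⟨h1, h2⟩)) h3)
  have h1 : 1 ≤ P.real (A n) + ∑ k ∈ Finset.Icc k₀ (K n), P.real (B n k) := by
    rw [← probReal_univ (μ := P)]
    exact (measureReal_mono hcover).trans ((measureReal_union_le _ _).trans
      (add_le_add le_rfl (measureReal_biUnion_finset_le _ _)))
  have h2 : ∑ k ∈ Finset.Icc k₀ (K n), P.real (B n k) ≤ 2 * (ρ ^ k₀ * (1 - ρ)⁻¹) := by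
    have hsum : HasSum (fun m : ℕ => 2 * (ρ ^ k₀ * ρ ^ m)) (2 * (ρ ^ k₀ * (1 - ρ)⁻¹)) :=
      ((hasSum_geometric_of_lt_one hρ.1.le hρ.2).mul_left _).mul_left _
    refine le_trans ?_ (sum_le_hasSum (Finset.range (K n + 1 - k₀))
      (fun m _ => mul_nonneg zero_le_two (mul_nonneg (pow_nonneg hρ.1.le _)
        (pow_nonneg hρ.1.le _))) hsum)
    rw [← Finset.Ico_add_one_right_eq_Icc, Finset.sum_Ico_eq_sum_range]
    refine Finset.sum_le_sum fun m hm => ?_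
    rw [← pow_add]
    have := Finset.mem_range.1 hm
    exact hBn _ (by omega) (by omega)
  change y < P.real (A n)
  linarith

/-! ### From linear bounds on `N_k(x)` to the decision -/

section Decision

variable {E : Type*} [PseudoMetricSpace E] {N : ℕ → Fin 2 → ℕ} {K : ℕ → ℕ} {q β : ℝ} {x : E}
  {k₀ : ℕ}

theorem eventually_assignedTo_zero (hq : 0 < q) (hq1 : q < 1) (hβ : 1 / q < β)
    (hN : Tendsto (fun n => minorityProportion (N n)) atTop (𝓝 q)) (hK : Tendsto K atTop atTop)
    (hKN : ∀ᶠ n in atTop, K n ≤ N n 1) (hk₀ : 1 ≤ k₀) :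
    ∀ᶠ n in atTop, ∀ z : SampleIdx (N n) → E,
      (∀ k, k₀ ≤ k → k ≤ K n → β * k ≤ neighborsNeeded x z k) → AssignedTo x z (K n) 0 := by
  obtain ⟨ρ, hρ, hnb⟩ := exists_one_sub_pow_le_sum_negBinomialPMF hq hq1 hβ
  -- The first term bounds the evidence below for `k ≤ k₀`, where eventually `p₀ > q / 2`; the
  -- second does so for `k ≥ k₀`, by `ρ ^ k ≤ ρ`.
  set η : ℝ := min ((q / 2) ^ k₀ / 2) (1 - ρ) with hη
  have hη0 : 0 < η := lt_min (by positivity) (by linarith [hρ.2])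
  filter_upwards [hN.eventually hnb, hN.eventually_const_lt (half_lt_self hq),
    hN.eventually_lt_const hq1, hKN, hK.eventually_ge_atTop k₀,
    ((tendsto_pow_atTop_nhds_zero_of_lt_one hρ.1.le hρ.2).comp hK).eventually_lt_const hη0]
    with n hnb hp hp1 hKN hKk hρK z hz
  have hp0 : 0 ≤ minorityProportion (N n) := by linarith
  have hlarge : ∀ k, k₀ ≤ k → k ≤ K n → 1 - ρ ^ k ≤ evidence x z k := fun k h1 h2 =>
    (hnb k _ (hk₀.trans h1) (hz k h1 h2)).trans (sum_range_le_evidence hp0 hp1.le)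
  refine assignedTo_zero_of_le_evidence (η := η) (hk₀.trans hKk) (fun k hk => ?_) ?_
  · rw [Finset.mem_Icc] at hk
    rcases le_total k₀ k with h | h
    · have : ρ ^ k ≤ ρ := pow_le_of_le_one hρ.1.le hρ.2.le (by omega)
      exact (min_le_right _ _).trans (le_trans (by linarith) (hlarge k h hk.2))
    · refine (min_le_left _ _).trans (le_trans ?_
        (pow_div_two_le_evidence hp0 hp1.le (hk.2.trans hKN)))
      have h3 : (q / 2) ^ k₀ ≤ (q / 2) ^ k := pow_le_pow_of_le_one (by positivity) (by linarith) h
      have h4 : (q / 2) ^ k ≤ minorityProportion (N n) ^ k := by gcongr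
      linarith
  · have := hlarge (K n) hKk le_rfl
    dsimp only [Function.comp] at hρK
    linarith

theorem eventually_assignedTo_one (hq : 0 < q) (hq1 : q < 1) (hβ : β < 1 / q)
    (hN : Tendsto (fun n => minorityProportion (N n)) atTop (𝓝 q)) (hK : Tendsto K atTop atTop)
    (hKN : ∀ᶠ n in atTop, K n ≤ N n 1) (hk₀ : 1 ≤ k₀) :
    ∀ᶠ n in atTop, ∀ z : SampleIdx (N n) → E,
      (∀ k, k₀ ≤ k → k ≤ K n → neighborsNeeded x z k ≤ β * k) → AssignedTo x z (K n) 1 := by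
  obtain ⟨ρ, hρ, hnb⟩ := exists_sum_negBinomialPMF_le_pow hq hq1 hβ
  -- Monotonicity of `N_k(x)` in `k` bounds it by `L` for all `k ≤ k₀`, which keeps `η` independent
  -- of `n`.
  set L : ℕ := ⌊β * k₀⌋₊ with hL
  set η : ℝ := min ((q / 2) ^ k₀ * ((1 - q) / 2) ^ L / 2) (1 - ρ) with hη
  have hq' : 0 < (1 - q) / 2 := by linarith
  have hη0 : 0 < η := lt_min (by positivity) (by linarith [hρ.2])
  filter_upwards [hN.eventually hnb, hN.eventually_const_lt (half_lt_self hq),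
    hN.eventually_lt_const (by linarith : q < 1 - (1 - q) / 2), hKN, hK.eventually_ge_atTop k₀,
    ((tendsto_pow_atTop_nhds_zero_of_lt_one hρ.1.le hρ.2).comp hK).eventually_lt_const hη0]
    with n hnb hp hp1 hKN hKk hρK z hz
  have hp0 : 0 < minorityProportion (N n) := by linarith
  have hp1' : minorityProportion (N n) ≤ 1 := by linarith
  have hlarge : ∀ k, k₀ ≤ k → k ≤ K n → evidence x z k ≤ ρ ^ k := fun k h1 h2 => by
    have h3 := hnb k _ (hk₀.trans h1) (hz k h1 h2)
    rw [evidence_eq_sum_range_succ_sub]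
    linarith [negBinomialPMF_nonneg (k := k) hp0.le hp1' (neighborsNeeded x z k)]
  refine assignedTo_one_of_evidence_le (η := η) (hk₀.trans hKk) (fun k hk => ?_) ?_
  · rw [Finset.mem_Icc] at hk
    rcases le_total k₀ k with h | h
    · have : ρ ^ k ≤ ρ := pow_le_of_le_one hρ.1.le hρ.2.le (by omega)
      linarith [min_le_right ((q / 2) ^ k₀ * ((1 - q) / 2) ^ L / 2) (1 - ρ), hlarge k h hk.2]
    · have h1 := evidence_le_one_sub (x := x) (z := z) hp0 hp1' hk.1 (hk.2.trans hKN)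
      have hNL : neighborsNeeded x z k ≤ L :=
        (neighborsNeeded_mono h (hKk.trans hKN)).trans (Nat.le_floor (hz k₀ le_rfl hKk))
      have h3 : (q / 2) ^ k₀ ≤ minorityProportion (N n) ^ k :=
        (pow_le_pow_of_le_one (by positivity) (by linarith) h).trans (by gcongr)
      have h4 : ((1 - q) / 2) ^ L ≤ (1 - minorityProportion (N n)) ^ neighborsNeeded x z k :=
        (pow_le_pow_of_le_one hq'.le (by linarith) hNL).trans
          (pow_le_pow_left₀ hq'.le (by linarith) _)
      have h5 := mul_le_mul h3 h4 (by positivity) (by positivity)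
      linarith [min_le_left ((q / 2) ^ k₀ * ((1 - q) / 2) ^ L / 2) (1 - ρ)]
  · have := hlarge (K n) hKk le_rfl
    dsimp only [Function.comp] at hρK
    linarith

end Decision

/-! ### Limits of sample-size ratios -/

section SampleSizes

variable {N : ℕ → Fin 2 → ℕ} {q : Fin 2 → ℝ} {K : ℕ → ℕ}

theorem tendsto_minorityProportion (hN : ∀ n, N n 0 + N n 1 = n)
    (hN_lim : ∀ i, Tendsto (fun n => (N n i : ℝ) / (n : ℝ)) atTop (𝓝 (q i))) :
    Tendsto (fun n => minorityProportion (N n)) atTop (𝓝 (q 1)) := by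
  refine (hN_lim 1).congr fun n => ?_
  have h : ((N n 0 + N n 1 : ℕ) : ℝ) = (n : ℝ) := congrArg _ (hN n)
  rw [minorityProportion, ← h, Nat.cast_add]

theorem tendsto_div_of_tendsto_div_natCast {a b : ℕ → ℝ} {α γ : ℝ}
    (ha : Tendsto (fun n => a n / (n : ℝ)) atTop (𝓝 α))
    (hb : Tendsto (fun n => b n / (n : ℝ)) atTop (𝓝 γ)) (hγ : γ ≠ 0) :
    Tendsto (fun n => a n / b n) atTop (𝓝 (α / γ)) := by
  refine (ha.div hb hγ).congr' ?_
  filter_upwards [eventually_gt_atTop 0] with n hn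
  exact div_div_div_cancel_right₀ (Nat.cast_ne_zero.2 hn.ne') _ _

theorem eventually_pos_of_tendsto_div {M : ℕ → ℕ} {α : ℝ} (hα : 0 < α)
    (hM : Tendsto (fun n => (M n : ℝ) / (n : ℝ)) atTop (𝓝 α)) : ∀ᶠ n in atTop, 0 < M n := by
  filter_upwards [hM.eventually_const_lt hα] with n hn
  refine Nat.pos_of_ne_zero fun h => ?_
  simp [h] at hn

theorem eventually_le_of_tendsto_div {M : ℕ → ℕ} {α : ℝ} (hα : 0 < α)
    (hM : Tendsto (fun n => (M n : ℝ) / (n : ℝ)) atTop (𝓝 α))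
    (hK : Tendsto (fun n => (K n : ℝ) / (n : ℝ)) atTop (𝓝 0)) : ∀ᶠ n in atTop, K n ≤ M n := by
  filter_upwards [hK.eventually_lt hM hα, eventually_gt_atTop 0] with n hn hn0
  rw [div_lt_div_iff_of_pos_right (by exact_mod_cast hn0)] at hn
  exact_mod_cast hn.le

end SampleSizes

/-! ### Deviations of `N_k(x)`, uniformly in `k ≤ k_max` -/

section Consistency

variable {d : ℕ} {Ω : Type*} [MeasurableSpace Ω] {P : Measure Ω} [IsProbabilityMeasure P]
  {f : Fin 2 → EuclideanSpace ℝ (Fin d) → ℝ} {N : ℕ → Fin 2 → ℕ}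
  {X : ∀ n : ℕ, SampleIdx (N n) → Ω → EuclideanSpace ℝ (Fin d)} {q : Fin 2 → ℝ} {K : ℕ → ℕ}
  {x : EuclideanSpace ℝ (Fin d)}

theorem exists_neighborsNeeded_lower_bound (hd : d ≠ 0) (hf : ∀ i, Continuous (f i))
    (hf0 : ∀ i y, 0 ≤ f i y) (hfi : ∀ i, Integrable (f i))
    (hlaw : ∀ n a, HasLaw (X n a) (volume.withDensity fun y => ENNReal.ofReal (f a.1 y)) P)
    (hind : ∀ n, iIndepFun (X n) P) (hq0 : ∀ i, 0 < q i) (hq_sum : q 0 + q 1 = 1)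
    (hN : ∀ i, Tendsto (fun n => (N n i : ℝ) / (n : ℝ)) atTop (𝓝 (q i)))
    (hK : Tendsto (fun n => (K n : ℝ) / (n : ℝ)) atTop (𝓝 0)) (hx : f 1 x < f 0 x) :
    ∃ β > 1 / q 1, ∃ ρ ∈ Set.Ioo (0 : ℝ) 1, ∀ᶠ n in atTop, ∀ k, 1 ≤ k → k ≤ K n →
      P.real {ω | (neighborsNeeded x (fun a => X n a ω) k : ℝ) < β * k} ≤ 2 * ρ ^ k := by
  obtain ⟨a, ha1, ha⟩ := exists_between hx
  obtain ⟨c', hc'1, hc'⟩ := exists_between ha1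
  obtain ⟨c, hc1, hc⟩ := exists_between hc'1
  obtain ⟨b, hb1, hb⟩ := exists_between hc1
  have hb0 : 0 < b := (hf0 1 x).trans_lt hb1
  have hc0 : 0 < c := hb0.trans hb
  have hc'0 : 0 < c' := hc0.trans hc
  have hτ : 1 < c' / c := (one_lt_div hc0).2 hc
  obtain ⟨v₀, hv₀, hball⟩ := exists_measureReal_ball_le_and_le (x := x) hd (hf 0) (hfi 0) (hf 1)
    (hc'0.trans hc').le hb0.le ha hb1
  have hw : 0 < q 0 / q 1 := div_pos (hq0 0) (hq0 1)
  have hinv : 1 / q 1 = 1 + q 0 / q 1 := by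
    have := (hq0 1).ne'
    field_simp
    linarith
  -- The gap `c < c'` is what leaves room for `β` strictly between the null slope and the limiting
  -- threshold.
  have hlt : 1 / q 1 < 1 + c' / c * (q 0 / q 1) := by
    rw [hinv]
    linarith [mul_lt_mul_of_pos_right hτ hw]
  obtain ⟨β, hβ1, hβ2⟩ := exists_between hlt
  have hratio := ((tendsto_div_of_tendsto_div_natCast (hN 0) (hN 1) (hq0 1).ne').const_mul (c' / c))
  have hKN := (tendsto_div_of_tendsto_div_natCast hK (hN 1) (hq0 1).ne').div_const c
  rw [zero_div, zero_div] at hKN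
  obtain ⟨ρ, hρ, hexp⟩ := exists_exp_add_exp_le_two_mul_pow
    (log_add_one_sub_neg (div_pos hb0 hc0) ((div_lt_one hc0).2 hb).ne)
    (log_add_one_sub_neg (div_pos (hc'0.trans hc') hc'0) ((one_lt_div hc'0).2 hc').ne')
    (half_pos (mul_pos (one_pos.trans hτ) hw))
  refine ⟨β, hβ1, ρ, hρ, ?_⟩
  filter_upwards [eventually_pos_of_tendsto_div (hq0 1) (hN 1),
    eventually_le_of_tendsto_div (hq0 1) (hN 1) hK, hKN.eventually_lt_const hv₀,
    hratio.eventually_const_lt (half_lt_self (mul_pos (one_pos.trans hτ) hw)),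
    (hratio.const_add 1).eventually_const_lt hβ2] with n hn hKn hv hu hβ k _ hk
  -- All volumes with `k ≤ K n` are at most the one for `K n`, which tends to 0.
  obtain ⟨r, h0, h1⟩ := hball (k / (N n 1 * c)) (by positivity) (lt_of_le_of_lt (by
    rw [div_div]
    gcongr) hv)
  refine le_trans (measureReal_mono fun ω hω => ?_) ((measureReal_neighborsNeeded_lt_le (hlaw n)
    (hind n) (μ := fun i => volume.withDensity fun y => ENNReal.ofReal (f i y)) hn
    (hk.trans hKn) hb0 hb hc hc' h1 h0).trans (hexp k _ hu.le))
  exact lt_of_lt_of_le hω (mul_le_mul_of_nonneg_right hβ.le (Nat.cast_nonneg k))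

theorem exists_neighborsNeeded_upper_bound (hd : d ≠ 0) (hf : ∀ i, Continuous (f i))
    (hf0 : ∀ i y, 0 ≤ f i y) (hfi : ∀ i, Integrable (f i))
    (hlaw : ∀ n a, HasLaw (X n a) (volume.withDensity fun y => ENNReal.ofReal (f a.1 y)) P)
    (hind : ∀ n, iIndepFun (X n) P) (hq0 : ∀ i, 0 < q i) (hq_sum : q 0 + q 1 = 1)
    (hN : ∀ i, Tendsto (fun n => (N n i : ℝ) / (n : ℝ)) atTop (𝓝 (q i)))
    (hK : Tendsto (fun n => (K n : ℝ) / (n : ℝ)) atTop (𝓝 0)) (hx : f 0 x < f 1 x) :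
    ∃ β < 1 / q 1, ∃ ρ ∈ Set.Ioo (0 : ℝ) 1, ∀ᶠ n in atTop, ∀ k, 1 ≤ k → k ≤ K n →
      P.real {ω | β * k < (neighborsNeeded x (fun a => X n a ω) k : ℝ)} ≤ 2 * ρ ^ k := by
  obtain ⟨a, ha1, ha⟩ := exists_between hx
  obtain ⟨c, hc1, hc⟩ := exists_between ha1
  obtain ⟨c', hc'1, hc'⟩ := exists_between hc1
  -- Now `c' < c`: the threshold slope must fall below `1 / q 1`.
  obtain ⟨b, hb1, hb⟩ := exists_between hc'1
  have hb0 : 0 < b := (hf0 0 x).trans_lt hb1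
  have hc'0 : 0 < c' := hb0.trans hb
  have hc0 : 0 < c := hc'0.trans hc'
  have hτ : c' / c < 1 := (div_lt_one hc0).2 hc'
  have hτ0 : 0 < c' / c := div_pos hc'0 hc0
  obtain ⟨v₀, hv₀, hball⟩ := exists_measureReal_ball_le_and_le (x := x) hd (hf 1) (hfi 1) (hf 0)
    (hc0.trans hc).le hb0.le ha hb1
  have hw : 0 < q 0 / q 1 := div_pos (hq0 0) (hq0 1)
  have hinv : 1 / q 1 = 1 + q 0 / q 1 := by
    have := (hq0 1).ne'
    field_simp
    linarith
  have hlt : 1 + c' / c * (q 0 / q 1) < 1 / q 1 := by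
    rw [hinv]
    linarith [mul_lt_mul_of_pos_right hτ hw]
  obtain ⟨β, hβ2, hβ1⟩ := exists_between hlt
  have hratio := ((tendsto_div_of_tendsto_div_natCast (hN 0) (hN 1) (hq0 1).ne').const_mul (c' / c))
  have hKN := (tendsto_div_of_tendsto_div_natCast hK (hN 1) (hq0 1).ne').div_const c
  rw [zero_div, zero_div] at hKN
  obtain ⟨ρ, hρ, hexp⟩ := exists_exp_add_exp_le_two_mul_pow
    (log_add_one_sub_neg (div_pos (hc0.trans hc) hc0) ((one_lt_div hc0).2 hc).ne')
    (log_add_one_sub_neg (div_pos hb0 hc'0) ((div_lt_one hc'0).2 hb).ne)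
    (half_pos (mul_pos hτ0 hw))
  refine ⟨β, hβ1, ρ, hρ, ?_⟩
  filter_upwards [eventually_pos_of_tendsto_div (hq0 1) (hN 1), hKN.eventually_lt_const hv₀,
    hratio.eventually_const_lt (half_lt_self (mul_pos hτ0 hw)),
    (hratio.const_add 1).eventually_lt_const hβ2] with n hn hv hu hβ k _ hk
  obtain ⟨r, h1, h0⟩ := hball (k / (N n 1 * c)) (by positivity) (lt_of_le_of_lt (by
    rw [div_div]
    gcongr) hv)
  refine le_trans (measureReal_mono fun ω hω => ?_) ((measureReal_lt_neighborsNeeded_le (hlaw n)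
    (hind n) (μ := fun i => volume.withDensity fun y => ENNReal.ofReal (f i y)) hn
    hb0 hb hc' hc h1 h0).trans (hexp k _ hu.le))
  exact lt_of_le_of_lt (mul_le_mul_of_nonneg_right hβ.le (Nat.cast_nonneg k)) hω

end Consistency

end ImbalancedNN

theorem theorem1 {d : ℕ} {Ω : Type*} [MeasurableSpace Ω] (P : Measure Ω) [IsProbabilityMeasure P]
    -- the two class densities
    (f : Fin 2 → EuclideanSpace ℝ (Fin d) → ℝ)
    (hf_cont : ∀ i, Continuous (f i)) (hf_nonneg : ∀ i y, 0 ≤ f i y)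
    (hf_one : ∀ i, ∫ y, f i y = 1)
    -- class sample sizes: `N n i` of the `n` training observations belong to class `i`
    (N : ℕ → Fin 2 → ℕ) (hN : ∀ n, N n 0 + N n 1 = n)
    -- training samples: for every `n`, independent observations, those of class `i` with density `f i`
    (X : ∀ n : ℕ, ImbalancedNN.SampleIdx (N n) → Ω → EuclideanSpace ℝ (Fin d))
    (hX_law : ∀ n a, HasLaw (X n a) (volume.withDensity (fun y => ENNReal.ofReal (f a.1 y))) P)
    (hX_indep : ∀ n, iIndepFun (X n) P)
    -- asymptotic class proportions
    (q : Fin 2 → ℝ) (hq : ∀ i, q i ∈ Set.Ioo (0 : ℝ) 1) (hq_order : q 1 ≤ q 0)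
    (hq_sum : q 0 + q 1 = 1)
    (hN_lim : ∀ i, Tendsto (fun n => (N n i : ℝ) / (n : ℝ)) atTop (𝓝 (q i)))
    -- the maximal number of minority class neighbors
    (kmax : ℕ → ℕ) (hk_top : Tendsto kmax atTop atTop)
    (hk_lim : Tendsto (fun n => (kmax n : ℝ) / (n : ℝ)) atTop (𝓝 0))
    -- the query point
    (x : EuclideanSpace ℝ (Fin d)) (i j : Fin 2) (hij : i ≠ j) (hx : f j x < f i x) :
    Tendsto (fun n => P {ω | ImbalancedNN.AssignedTo x (fun a => X n a ω) (kmax n) i})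
      atTop (𝓝 1) := by
  have hfi : ∀ i, Integrable (f i) := fun i => by
    by_contra h
    simpa [integral_undef h] using hf_one i
  have hd : d ≠ 0 := by
    rintro rfl
    exact hx.ne (ImbalancedNN.eq_of_integral_eq_one_of_dim_zero (hf_one j) (hf_one i) x)
  have hq0 : ∀ i, 0 < q i := fun i => (hq i).1
  have hprop := ImbalancedNN.tendsto_minorityProportion hN hN_lim
  have hKN := ImbalancedNN.eventually_le_of_tendsto_div (hq0 1) (hN_lim 1) hk_lim
  obtain ⟨rfl, rfl⟩ | ⟨rfl, rfl⟩ : i = 0 ∧ j = 1 ∨ i = 1 ∧ j = 0 := by omega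
  · obtain ⟨β, hβ, ρ, hρ, h⟩ := ImbalancedNN.exists_neighborsNeeded_lower_bound hd hf_cont
      hf_nonneg hfi hX_law hX_indep hq0 hq_sum hN_lim hk_lim hx
    refine ImbalancedNN.tendsto_measure_one_of_forall_notMem hρ h fun k₀ hk₀ => ?_
    filter_upwards [ImbalancedNN.eventually_assignedTo_zero (x := x) (hq0 1) (hq 1).2 hβ hprop
      hk_top hKN hk₀] with n hn ω hω
    exact hn _ fun k h1 h2 => not_lt.1 (hω k h1 h2)
  · obtain ⟨β, hβ, ρ, hρ, h⟩ := ImbalancedNN.exists_neighborsNeeded_upper_bound hd hf_cont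
      hf_nonneg hfi hX_law hX_indep hq0 hq_sum hN_lim hk_lim hx
    refine ImbalancedNN.tendsto_measure_one_of_forall_notMem hρ h fun k₀ hk₀ => ?_
    filter_upwards [ImbalancedNN.eventually_assignedTo_one (x := x) (hq0 1) (hq 1).2 hβ hprop
      hk_top hKN hk₀] with n hn ω hω
    exact hn _ fun k h1 h2 => not_lt.1 (hω k h1 h2)
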